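/- Let $m\ge 1$ and $N_1,\dots,N_{m-1}\ge 1$ be integers, put $N_m:=1$, $n:=N_1+\dots+N_m$, and write $x=(X_1,\dots,X_{m-1},x_n)\in\mathbb R^{N_1}\times\dots\times\mathbb R^{N_{m-1}}\times\mathbb R=\mathbb R^n$; let $e_n$ be the last vector of the standard basis. Let $s_1,\dots,s_{m-1}\in(0,1]$, $s_m:=1$, $a_1,\dots,a_{m-1}\ge 0$, $a_m:=a>0$, and $$L:=\sum_{i=1}^{m-1}a_i(-\Delta_{X_i})^{s_i}-a\,\partial^2_{x_n},$$ where $(-\Delta_{X_i})^{1}$ is minus the sum of the second partial derivatives in the variables of the group $X_i$ and, for $s_i\in(0,1)$, $$(-\Delta_{X_i})^{s_i}u(x):=c_{N_i,s_i}\int_{\mathbb R^{N_i}}\frac{2u(x)-u(x+y^{(i)})-u(x-y^{(i)})}{|y|^{N_i+2s_i}}\,dy,\qquad c_{N,s}:=\frac{2^{2s-1}\Gamma(s+\frac N2)}{\pi^{N/2}|\Gamma(-s)|},$$ $y^{(i)}\in\mathbb R^n$ being the vector whose $i$-th group of coordinates is $y$ and whose other coordinates are $0$. Let $d_1,\dots,d_m>0$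 and, for $\kappa>0$, $$Q_{d,\kappa}:=\{x\in\mathbb R^n:\ |X_i|<d_i\ (1\le i\le m-1),\ |x_n|<\kappa d_m\},\qquad Q_d:=Q_{d,1}.$$ Let $f:Q_{d,2}\to\mathbb R$ and let $u:\mathbb R^n\to\mathbb R$ be a classical solution of $Lu=f$ in $Q_{d,2}$, i.e. $u$ is continuous on $\mathbb R^n$ and at every point of $Q_{d,2}$ the terms of $Lu$ with non-zero coefficient can be computed pointwise (the second partial derivatives involved exist and the integrals involved converge absolutely) and $Lu=f$. Then, for every $t\in(-d_m,d_m)$ with $t\ne0$, $$\frac{|u(te_n)-u(-te_n)|}{|t|}\le\frac{d_m\,\mathfrak S}{a}+\frac{\tilde C\,d_m\,\|u\|_{L^\infty(\mathbb R^n)}}{\min_{1\le i\le m}\big(\eta_i d_i^{2s_i}\big)},$$ where $$\mathfrak S:=\sup_{(x,\tau)\in Q_d\times(0,d_m)}|f(x+\tau e_n)-f(x-\tau e_n)|,\qquad \tilde C:=\frac{2(a_1+\dots+a_m)}{a}+1,\qquad \eta_i:=\frac{\Gamma(\frac{N_i}2)}{2^{2s_i}\,\Gamma(s_i+1)\,\Gamma(s_i+\frac{N_i}2)}.$$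 The right-hand side is understood in $[0,+\infty]$ (the estimate is trivial if $\mathfrak S$ or $\|u\|_{L^\infty(\mathbb R^n)}$ is infinite). -/

import Mathlib

open MeasureTheory Topology
open scoped ENNReal

noncomputable section

namespace Aniso

/-- The space `ℝⁿ`, with its coordinates split as `x = (X₁, …, X_k, x_n)`: there are `k = m - 1`
groups of variables `X_i ∈ ℝ^{N_i}` (with the Euclidean norm) and one last scalar variable `x_n`,
so that `n = N₁ + ⋯ + N_k + 1`. It carries the product topology and the Lebesgue measure. -/
abbrev Space {k : ℕ} (N : Fin k → ℕ) : Type :=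
  ((i : Fin k) → EuclideanSpace ℝ (Fin (N i))) × ℝ

variable {k : ℕ} {N : Fin k → ℕ}

/-- The increment `y^{(i)} ∈ ℝⁿ` induced by `y ∈ ℝ^{N_i}` in the `i`-th group of variables. -/
def incr (i : Fin k) (y : EuclideanSpace ℝ (Fin (N i))) : Space N := (Pi.single i y, 0)

/-- The last vector `e_n` of the standard basis. -/
def eLast (N : Fin k → ℕ) : Space N := (0, 1)

/-- The basis vector of `ℝⁿ` of the `j`-th variable in the `i`-th group. -/
def eGroup (i : Fin k) (j : Fin (N i)) : Space N := incr i (EuclideanSpace.single j 1)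

/-- The second derivative of `u` at `x` in the direction `w`, that is, the second derivative at
`τ = 0` of `τ ↦ u (x + τ w)`. -/
def secondDeriv (u : Space N → ℝ) (w x : Space N) : ℝ :=
  deriv (deriv (fun τ : ℝ => u (x + τ • w))) 0

/-- The second derivative of `u` at `x` in the direction `w` exists. -/
def HasSecondDeriv (u : Space N → ℝ) (w x : Space N) : Prop :=
  (∀ᶠ τ in 𝓝 (0 : ℝ), DifferentiableAt ℝ (fun τ : ℝ => u (x + τ • w)) τ) ∧
    DifferentiableAt ℝ (deriv (fun τ : ℝ => u (x + τ • w))) 0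

/-- The normalization constant `c_{N,s}` of the fractional Laplacian. -/
def normConst (N : ℕ) (s : ℝ) : ℝ :=
  (2 : ℝ) ^ (2 * s - 1) * Real.Gamma (s + (N : ℝ) / 2) /
    (Real.pi ^ ((N : ℝ) / 2) * |Real.Gamma (-s)|)

/-- The integrand in the definition of `(-Δ_{X_i})^s u (x)`, for `s ∈ (0,1)`. -/
def fracIntegrand (i : Fin k) (s : ℝ) (u : Space N → ℝ) (x : Space N)
    (y : EuclideanSpace ℝ (Fin (N i))) : ℝ :=
  (2 * u x - u (x + incr i y) - u (x - incr i y)) / ‖y‖ ^ ((N i : ℝ) + 2 * s)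

/-- The (possibly fractional) `s`-Laplacian `(-Δ_{X_i})^s u (x)` in the `i`-th group of variables,
for `s ∈ (0,1]`. -/
def fracLap (i : Fin k) (s : ℝ) (u : Space N → ℝ) (x : Space N) : ℝ :=
  if s = 1 then -∑ j : Fin (N i), secondDeriv u (eGroup i j) x
  else normConst (N i) s * ∫ y : EuclideanSpace ℝ (Fin (N i)), fracIntegrand i s u x y

/-- `u` is regular enough at `x` for `(-Δ_{X_i})^s u (x)` to be computed pointwise. -/
def FracLapExists (i : Fin k) (s : ℝ) (u : Space N → ℝ) (x : Space N) : Prop :=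
  if s = 1 then ∀ j : Fin (N i), HasSecondDeriv u (eGroup i j) x
  else Integrable (fun y : EuclideanSpace ℝ (Fin (N i)) => fracIntegrand i s u x y)

/-- The operator `L = ∑ a_i (-Δ_{X_i})^{s_i} - a ∂²_{x_n}`, the sum being over the first
`k = m - 1` groups of variables. -/
def opL (s a : Fin k → ℝ) (aLast : ℝ) (u : Space N → ℝ) (x : Space N) : ℝ :=
  ∑ i, a i * fracLap i (s i) u x - aLast * secondDeriv u (eLast N) x

/-- The cylinder `Q_{d,κ} = B_{d_1} × ⋯ × B_{d_{m-1}} × (-κ d_m, κ d_m)`. -/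
def cylinder (N : Fin k → ℕ) (d : Fin k → ℝ) (dLast κ : ℝ) : Set (Space N) :=
  (Set.univ.pi fun i => Metric.ball (0 : EuclideanSpace ℝ (Fin (N i))) (d i)) ×ˢ
    Set.Ioo (-(κ * dLast)) (κ * dLast)

/-- `u` is a classical solution of `L u = f` in the set `Q`: `u` is continuous on `ℝⁿ`, and at
every point of `Q` all the terms of `L u` can be computed and `L u = f` (a term whose coefficient
`a_i` vanishes is absent from `L`, and nothing is required for it). -/
structure IsClassicalSolution (s a : Fin k → ℝ) (aLast : ℝ) (Q : Set (Space N))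
    (f u : Space N → ℝ) : Prop where
  continuous : Continuous u
  fracLapExists : ∀ x ∈ Q, ∀ i, a i ≠ 0 → FracLapExists i (s i) u x
  hasSecondDeriv : ∀ x ∈ Q, HasSecondDeriv u (eLast N) x
  eq : ∀ x ∈ Q, opL s a aLast u x = f x

/-- The constant `η = Γ(N/2) / (2^{2s} Γ(s+1) Γ(s+N/2))`. -/
def eta (N : ℕ) (s : ℝ) : ℝ :=
  Real.Gamma ((N : ℝ) / 2) /
    ((2 : ℝ) ^ (2 * s) * Real.Gamma (s + 1) * Real.Gamma (s + (N : ℝ) / 2))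

/-- `min_{i ∈ {1,…,m}} η_i d_i^{2 s_i}`, where `N_m = 1` and `s_m = 1`. -/
def minEta (N : Fin k → ℕ) (s d : Fin k → ℝ) (dLast : ℝ) : ℝ :=
  Finset.univ.fold min (eta 1 1 * dLast ^ 2) (fun i => eta (N i) (s i) * d i ^ (2 * s i))

/-- `𝔖`, the supremum of `|f (x + t e_n) - f (x - t e_n)|` over `x ∈ Q_d` and `t ∈ (0, d_m)`,
as an element of `[0, ∞]`. -/
def oscLast (d : Fin k → ℝ) (dLast : ℝ) (f : Space N → ℝ) : ℝ≥0∞ :=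
  ⨆ x ∈ cylinder N d dLast 1, ⨆ t ∈ Set.Ioo 0 dLast,
    ENNReal.ofReal |f (x + t • eLast N) - f (x - t • eLast N)|

/-- `C̃ = 2 (a_1 + ⋯ + a_m) / a + 1`, where `a_m = a`. -/
def constC (a : Fin k → ℝ) (aLast : ℝ) : ℝ :=
  2 * (∑ i, a i + aLast) / aLast + 1

end Aniso

end

/-!
The proof is a comparison argument in the doubled variable. Freeze the last coordinate at the
centre and set `v (X, t) = u (X, t) - u (X, -t)` for `t ∈ [0, d_m]`. Since `v` is odd in `t`, it
vanishes at `t = 0`, it is bounded by `2 ‖u‖` everywhere, and it satisfies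
`∑ a_i (-Δ_{X_i})^{s_i} v - a ∂_t² v = f (X, t) - f (X, -t) ≤ 𝔖` in the cylinder. The barrier is
`2 ‖u‖ (∑ i, min (|X_i|² / d_i²) 1 + t / d_m) + P t (d_m - t)`. It dominates `v` where `t = 0`,
where `t = d_m` and where some `|X_i| ≥ d_i`, so a negative minimum of barrier minus `v` would be
interior in the cylinder and global in the variables `X_i`; there the equation for `v` is
contradicted as soon as `2 a P` exceeds `𝔖` plus the contribution of the truncated paraboloids
(`reflect_sub_le_barrier`). At `X = 0` the barrier is `O(t)`, which is the estimate.

The constant comes out because the last variable enters only through `t`: the term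
`P t (d_m - t)` yields the full `2 a P`, which leaves a factor `2` to spare in the contribution of
each group `X_i`. The torsion function of the ball, with `(-Δ)^s` equal to `1 / (η d^{2s})` for
the profile of height `1`, can therefore be replaced by the truncated paraboloid: its second
differences are bounded by twice `min (|y|² / d²) 1`, the kernel integral of this is explicit, and
the quotient of the two values is `1 / (Γ(1 + s) Γ(2 - s)) ≤ 2`
(`normConst_mul_integral_min_le`, `one_le_two_mul_Gamma_mul_Gamma`).
-/

noncomputable section

namespace Aniso

variable {k : ℕ} {N : Fin k → ℕ}

/-! ### Second derivatives -/

/-- A twice differentiable function lying below a parabola that touches it at `0` has second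
derivative there at most that of the parabola. -/
lemma deriv_deriv_le_of_le_parabola {g : ℝ → ℝ} {b c : ℝ}
    (h1 : ∀ᶠ τ in 𝓝 (0 : ℝ), DifferentiableAt ℝ g τ) (h2 : DifferentiableAt ℝ (deriv g) 0)
    (hle : ∀ᶠ τ in 𝓝 0, g τ ≤ g 0 + b * τ + c * τ ^ 2) : deriv (deriv g) 0 ≤ 2 * c := by
  by_contra! hlt
  set q : ℝ → ℝ := fun τ => g τ - (b * τ + c * τ ^ 2) with hq
  have hd : deriv q =ᶠ[𝓝 0] fun τ => deriv g τ - (b + c * (2 * τ)) := by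
    filter_upwards [h1] with τ hτ
    have := hτ.hasDerivAt.sub
      (((hasDerivAt_id τ).const_mul b).add (((hasDerivAt_id τ).pow 2).const_mul c))
    refine (this.congr_deriv ?_).deriv
    simp
  have hdd : deriv (deriv q) 0 = deriv (deriv g) 0 - 2 * c := by
    rw [hd.deriv_eq]
    have := h2.hasDerivAt.sub
      ((((hasDerivAt_id (0 : ℝ)).const_mul 2).const_mul c).const_add b)
    refine (this.congr_deriv ?_).deriv
    simp [mul_comm]
  have hmax : IsLocalMax q 0 := by
    filter_upwards [hle] with τ hτ
    simp only [hq]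
    linarith
  have hcont : ContinuousAt q 0 :=
    (h1.self_of_nhds.continuousAt).sub (by fun_prop)
  have hmin : IsLocalMin q 0 :=
    isLocalMin_of_deriv_deriv_pos (by rw [hdd]; linarith) hmax.deriv_eq_zero hcont
  -- Being both a local maximum and a local minimum, `0` has a neighbourhood where `q` is constant.
  have hconst : q =ᶠ[𝓝 0] fun _ => q 0 := by
    filter_upwards [hmax, hmin] with τ h h' using le_antisymm h h'
  have hzero : deriv (deriv q) 0 = 0 := by
    rw [hconst.deriv.deriv_eq]
    simp
  linarith

lemma deriv_line_neg (u : Space N → ℝ) (w x : Space N) :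
    deriv (fun τ : ℝ => u (x + τ • -w)) = fun τ => -deriv (fun τ : ℝ => u (x + τ • w)) (-τ) := by
  funext τ
  rw [← deriv_comp_neg (fun τ : ℝ => u (x + τ • w)) τ]
  simp

lemma HasSecondDeriv.neg_dir {u : Space N → ℝ} {w x : Space N} (h : HasSecondDeriv u w x) :
    HasSecondDeriv u (-w) x := by
  have hneg : Filter.Tendsto (fun τ : ℝ => -τ) (𝓝 0) (𝓝 0) := by
    simpa using (continuous_neg (G := ℝ)).tendsto 0
  refine ⟨?_, ?_⟩
  · filter_upwards [hneg.eventually h.1] with τ hτ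
    simpa [Function.comp_def] using hτ.comp τ differentiable_neg.differentiableAt
  · have h2 := h.2
    rw [← neg_zero] at h2
    rw [deriv_line_neg]
    exact (h2.comp 0 differentiable_neg.differentiableAt).neg

lemma secondDeriv_neg_dir (u : Space N → ℝ) (w x : Space N) :
    secondDeriv u (-w) x = secondDeriv u w x := by
  unfold secondDeriv
  rw [deriv_line_neg, deriv.fun_neg, deriv_comp_neg (deriv fun τ : ℝ => u (x + τ • w)) 0]
  simp

/-- The parabola criterion for the difference of `u` along two lines, which may have
different base points and directions. -/
lemma secondDeriv_sub_le {u : Space N → ℝ} {w w' x x' : Space N} {b c : ℝ}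
    (h : HasSecondDeriv u w x) (h' : HasSecondDeriv u w' x')
    (hle : ∀ᶠ τ : ℝ in 𝓝 0, u (x + τ • w) - u (x' + τ • w') ≤ u x - u x' + b * τ + c * τ ^ 2) :
    secondDeriv u w x - secondDeriv u w' x' ≤ 2 * c := by
  have hd : deriv (fun τ : ℝ => u (x + τ • w) - u (x' + τ • w')) =ᶠ[𝓝 0]
      fun τ => deriv (fun τ : ℝ => u (x + τ • w)) τ - deriv (fun τ : ℝ => u (x' + τ • w')) τ := by
    filter_upwards [h.1, h'.1] with τ h1 h2
    exact deriv_fun_sub h1 h2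
  have := deriv_deriv_le_of_le_parabola (b := b) (c := c)
    (g := fun τ : ℝ => u (x + τ • w) - u (x' + τ • w'))
    (by filter_upwards [h.1, h'.1] with τ h1 h2 using h1.sub h2)
    (hd.differentiableAt_iff.2 (h.2.sub h'.2)) (by simpa using hle)
  rwa [hd.deriv_eq, deriv_fun_sub h.2 h'.2] at this

/-! ### The kernel integral and the constants -/

/-- In polar coordinates, the integral of `min (‖y‖² / d²) 1` against the kernel
`‖y‖ ^ (-n - 2 s)`: the part `r ≤ d` gives `d ^ (-2 s) / (2 - 2 s)`, the part `r > d` gives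
`d ^ (-2 s) / (2 s)`. -/
lemma integral_radial_min {n : ℕ} (hn : 1 ≤ n) {s d : ℝ} (hs : 0 < s) (hs1 : s < 1) (hd : 0 < d) :
    IntegrableOn (fun r : ℝ => r ^ (n - 1) • (min (r ^ 2 / d ^ 2) 1 / r ^ ((n : ℝ) + 2 * s)))
      (Set.Ioi 0) ∧
    ∫ r in Set.Ioi (0 : ℝ), r ^ (n - 1) • (min (r ^ 2 / d ^ 2) 1 / r ^ ((n : ℝ) + 2 * s)) =
      1 / (2 * s * (1 - s) * d ^ (2 * s)) := by
  set F := fun r : ℝ => r ^ (n - 1) • (min (r ^ 2 / d ^ 2) 1 / r ^ ((n : ℝ) + 2 * s)) with hF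
  have hker : ∀ r : ℝ, 0 < r → r ^ (n - 1) / r ^ ((n : ℝ) + 2 * s) = r ^ (-1 - 2 * s) := by
    intro r hr
    rw [← Real.rpow_natCast, ← Real.rpow_sub hr, Nat.cast_sub hn]
    congr 1
    push_cast
    ring
  have h0 : Set.EqOn F (fun r => r ^ (1 - 2 * s) / d ^ 2) (Set.Ioc 0 d) := by
    intro r hr
    have hmin : min (r ^ 2 / d ^ 2) 1 = r ^ 2 / d ^ 2 := by
      apply min_eq_left
      rw [div_le_one (by positivity)]
      exact pow_le_pow_left₀ hr.1.le hr.2 2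
    have : r ^ (1 - 2 * s) = r ^ (-1 - 2 * s) * r ^ 2 := by
      rw [← Real.rpow_natCast, ← Real.rpow_add hr.1]
      congr 1
      push_cast
      ring
    simp only [hF, smul_eq_mul]
    rw [hmin, this, ← hker r hr.1]
    ring
  have h1 : Set.EqOn F (fun r => r ^ (-1 - 2 * s)) (Set.Ioi d) := by
    intro r hr
    have hr' : d < r := hr
    have hmin : min (r ^ 2 / d ^ 2) 1 = 1 := by
      apply min_eq_right
      rw [one_le_div (by positivity)]
      exact pow_le_pow_left₀ hd.le hr'.le 2
    simp only [hF, smul_eq_mul]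
    rw [hmin, ← hker r (hd.trans hr')]
    ring
  have i0 : IntegrableOn F (Set.Ioc 0 d) := by
    rw [integrableOn_congr_fun h0 measurableSet_Ioc]
    exact ((intervalIntegrable_iff_integrableOn_Ioc_of_le hd.le).1
      (intervalIntegral.intervalIntegrable_rpow' (by linarith))).div_const _
  have i1 : IntegrableOn F (Set.Ioi d) := by
    rw [integrableOn_congr_fun h1 measurableSet_Ioi]
    exact integrableOn_Ioi_rpow_of_lt (by linarith) hd
  rw [← Set.Ioc_union_Ioi_eq_Ioi hd.le]
  refine ⟨i0.union i1, ?_⟩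
  rw [setIntegral_union (Set.Ioc_disjoint_Ioi le_rfl) measurableSet_Ioi i0 i1,
    setIntegral_congr_fun measurableSet_Ioc h0, setIntegral_congr_fun measurableSet_Ioi h1,
    integral_Ioi_rpow_of_lt (by linarith) hd, ← intervalIntegral.integral_of_le hd.le,
    intervalIntegral.integral_div, integral_rpow (Or.inl (by linarith)),
    Real.zero_rpow (by linarith)]
  have e1 : d ^ (1 - 2 * s + 1) = d ^ 2 / d ^ (2 * s) := by
    rw [← Real.rpow_natCast, ← Real.rpow_sub hd]
    congr 1
    push_cast
    ring
  have e2 : d ^ (-1 - 2 * s + 1) = 1 / d ^ (2 * s) := by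
    rw [one_div, ← Real.rpow_neg hd.le]
    congr 1
    ring
  have : d ^ (2 * s) ≠ 0 := (Real.rpow_pos_of_pos hd _).ne'
  have h3 : (1 - 2 * s + 1) ≠ 0 := by linarith
  have h4 : (-1 - 2 * s + 1) ≠ 0 := by linarith
  have h5 : 1 - s ≠ 0 := by linarith
  rw [e1, e2]
  field_simp
  ring

lemma eta_pos {n : ℕ} (hn : 1 ≤ n) {s : ℝ} (hs : 0 < s) : 0 < eta n s := by
  have : (0 : ℝ) < n := by exact_mod_cast hn
  unfold eta
  have := Real.Gamma_pos_of_pos (show (0 : ℝ) < n / 2 by positivity)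
  have := Real.Gamma_pos_of_pos (show (0 : ℝ) < s + 1 by positivity)
  have := Real.Gamma_pos_of_pos (show (0 : ℝ) < s + n / 2 by positivity)
  positivity

lemma eta_one {n : ℕ} (hn : 1 ≤ n) : eta n 1 = 1 / (2 * n) := by
  have h : (0 : ℝ) < n := by exact_mod_cast hn
  have hG := Real.Gamma_pos_of_pos (show (0 : ℝ) < n / 2 by positivity)
  have h2 : (2 : ℝ) ^ (2 * (1 : ℝ)) = 4 := by
    rw [mul_one, Real.rpow_two]; norm_num
  have h3 : Real.Gamma (1 + 1) = 1 := by rw [one_add_one_eq_two, Real.Gamma_two]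
  have h4 := Real.Gamma_add_one (s := (n : ℝ) / 2) (by positivity)
  unfold eta
  rw [add_comm (1 : ℝ) ((n : ℝ) / 2), h4, h2, h3]
  field_simp
  norm_num

lemma normConst_nonneg {n : ℕ} (hn : 1 ≤ n) {s : ℝ} (hs : 0 < s) : 0 ≤ normConst n s := by
  have : (0 : ℝ) < n := by exact_mod_cast hn
  have := Real.Gamma_pos_of_pos (show (0 : ℝ) < s + n / 2 by positivity)
  unfold normConst
  positivity

/-- `Γ(1 + s) Γ(2 - s) ≥ 1 / 2`: by Euler's reflection formula the product is
`π s (1 - s) / sin (π s)`, and `sin (π s)` is at most `π s` and at most `π (1 - s)`. -/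
lemma one_le_two_mul_Gamma_mul_Gamma {s : ℝ} (hs : 0 < s) (hs1 : s < 1) :
    1 ≤ 2 * (Real.Gamma (s + 1) * ((1 - s) * Real.Gamma (1 - s))) := by
  have hpi := Real.pi_pos
  have hsin : 0 < Real.sin (Real.pi * s) :=
    Real.sin_pos_of_pos_of_lt_pi (by positivity) (by nlinarith)
  have hle1 : Real.sin (Real.pi * s) ≤ Real.pi * s := Real.sin_le (by positivity)
  have hle2 : Real.sin (Real.pi * s) ≤ Real.pi * (1 - s) := by
    rw [← Real.sin_pi_sub, show Real.pi - Real.pi * s = Real.pi * (1 - s) by ring]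
    exact Real.sin_le (mul_nonneg hpi.le (by linarith))
  have h : 2 * (Real.Gamma (s + 1) * ((1 - s) * Real.Gamma (1 - s))) =
      2 * s * (1 - s) * Real.pi / Real.sin (Real.pi * s) := by
    rw [Real.Gamma_add_one hs.ne', mul_div_assoc, ← Real.Gamma_mul_Gamma_one_sub]
    ring
  rw [h, one_le_div hsin]
  nlinarith

/-- The integral bounding the fractional Laplacian of `1 - min (‖y‖² / d²) 1` in the ball is at
most twice the value `1 / (η d ^ (2 s))` of the fractional Laplacian of the (optimal) torsion
function `(1 - ‖y‖² / d²)₊ ^ s`. -/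
lemma normConst_mul_integral_min_le {n : ℕ} (hn : 1 ≤ n) {s d : ℝ} (hs : 0 < s) (hs1 : s < 1)
    (hd : 0 < d) :
    Integrable (fun y : EuclideanSpace ℝ (Fin n) =>
      min (‖y‖ ^ 2 / d ^ 2) 1 / ‖y‖ ^ ((n : ℝ) + 2 * s)) ∧
    normConst n s * ∫ y : EuclideanSpace ℝ (Fin n),
      2 * (min (‖y‖ ^ 2 / d ^ 2) 1 / ‖y‖ ^ ((n : ℝ) + 2 * s)) ≤ 2 / (eta n s * d ^ (2 * s)) := by
  have hne : Nonempty (Fin n) := ⟨⟨0, hn⟩⟩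
  have hnt : Nontrivial (EuclideanSpace ℝ (Fin n)) := by
    have : 0 < Module.finrank ℝ (EuclideanSpace ℝ (Fin n)) := by
      rw [finrank_euclideanSpace_fin]; exact hn
    exact Module.nontrivial_of_finrank_pos this
  obtain ⟨hi, hv⟩ := integral_radial_min hn hs hs1 hd
  have hn0 : (0 : ℝ) < n := by exact_mod_cast hn
  refine ⟨?_, ?_⟩
  · refine (integrable_fun_norm_addHaar (E := EuclideanSpace ℝ (Fin n)) volume
      (f := fun r : ℝ => min (r ^ 2 / d ^ 2) 1 / r ^ ((n : ℝ) + 2 * s))).2 ?_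
    rwa [finrank_euclideanSpace_fin]
  · have hI := integral_fun_norm_addHaar (E := EuclideanSpace ℝ (Fin n)) volume
      (fun r : ℝ => min (r ^ 2 / d ^ 2) 1 / r ^ ((n : ℝ) + 2 * s))
    rw [finrank_euclideanSpace_fin, hv] at hI
    have hG0 := Real.Gamma_pos_of_pos (show (0 : ℝ) < n / 2 by positivity)
    have hG1 := Real.Gamma_pos_of_pos (show (0 : ℝ) < s + n / 2 by positivity)
    have hG2 := Real.Gamma_pos_of_pos (show (0 : ℝ) < s + 1 by positivity)
    have hG3 := Real.Gamma_pos_of_pos (show (0 : ℝ) < 1 - s by linarith)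
    have hvol : (volume : Measure (EuclideanSpace ℝ (Fin n))).real (Metric.ball 0 1) =
        Real.pi ^ ((n : ℝ) / 2) / (n / 2 * Real.Gamma (n / 2)) := by
      rw [Measure.real, EuclideanSpace.volume_ball, Fintype.card_fin,
        Real.Gamma_add_one (by positivity), ENNReal.ofReal_one, one_pow, one_mul,
        ENNReal.toReal_ofReal (by positivity), Real.sqrt_eq_rpow, ← Real.rpow_natCast,
        ← Real.rpow_mul Real.pi_pos.le]
      congr 2
      ring
    have hGneg : |Real.Gamma (-s)| = Real.Gamma (1 - s) / s := by
      have := Real.Gamma_add_one (s := -s) (by linarith)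
      rw [show -s + 1 = 1 - s by ring] at this
      rw [← abs_of_pos hG3, this, abs_mul, abs_neg, abs_of_pos hs]
      field_simp
    have h2 : (2 : ℝ) ^ (2 * s - 1) = 2 ^ (2 * s) / 2 := by
      rw [Real.rpow_sub two_pos, Real.rpow_one]
    have hpi : 0 < Real.pi ^ ((n : ℝ) / 2) := Real.rpow_pos_of_pos Real.pi_pos _
    have hds : 0 < d ^ (2 * s) := Real.rpow_pos_of_pos hd _
    have h2s : (0 : ℝ) < 2 ^ (2 * s) := Real.rpow_pos_of_pos two_pos _
    have h1s : 0 < 1 - s := by linarith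
    have key := one_le_two_mul_Gamma_mul_Gamma hs hs1
    rw [integral_const_mul, hI, hvol, normConst, hGneg, h2, eta, nsmul_eq_mul, smul_eq_mul]
    calc _ = 2 ^ (2 * s) * Real.Gamma (s + n / 2) / (Real.Gamma (n / 2) * d ^ (2 * s)) *
          (1 / ((1 - s) * Real.Gamma (1 - s))) := by
          field_simp
      _ ≤ 2 ^ (2 * s) * Real.Gamma (s + n / 2) / (Real.Gamma (n / 2) * d ^ (2 * s)) *
          (2 * Real.Gamma (s + 1)) := by
          gcongr
          rw [div_le_iff₀ (by positivity)]
          linarith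
      _ = _ := by field_simp

/-! ### The truncated paraboloid -/

/-- The paraboloid `‖y‖² / d²`, truncated at the value `1` that it takes on the sphere of
radius `d`. -/
def truncParab {n : ℕ} (d : ℝ) (y : EuclideanSpace ℝ (Fin n)) : ℝ :=
  min (‖y‖ ^ 2 / d ^ 2) 1

lemma continuous_truncParab {n : ℕ} (d : ℝ) :
    Continuous (truncParab d : EuclideanSpace ℝ (Fin n) → ℝ) := by
  unfold truncParab
  fun_prop

lemma truncParab_nonneg {n : ℕ} (d : ℝ) (y : EuclideanSpace ℝ (Fin n)) : 0 ≤ truncParab d y :=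
  le_min (by positivity) zero_le_one

lemma truncParab_zero {n : ℕ} (d : ℝ) : truncParab d (0 : EuclideanSpace ℝ (Fin n)) = 0 := by
  simp [truncParab]

lemma truncParab_eq_one {n : ℕ} {d : ℝ} (hd : 0 < d) {y : EuclideanSpace ℝ (Fin n)}
    (hy : d ≤ ‖y‖) : truncParab d y = 1 := by
  apply min_eq_right
  rw [one_le_div (by positivity)]
  exact pow_le_pow_left₀ hd.le hy 2

lemma truncParab_eq_sq {n : ℕ} {d : ℝ} (hd : 0 < d) {y : EuclideanSpace ℝ (Fin n)}
    (hy : ‖y‖ ≤ d) : truncParab d y = ‖y‖ ^ 2 / d ^ 2 := by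
  apply min_eq_left
  rw [div_le_one (by positivity)]
  exact pow_le_pow_left₀ (norm_nonneg y) hy 2

/-- The second difference of `truncParab d` at a point of the ball is controlled by the
two bounds `‖·‖² / d²` (parallelogram law) and `1` on the function. -/
lemma truncParab_second_diff_le {n : ℕ} {d : ℝ} (hd : 0 < d) {x : EuclideanSpace ℝ (Fin n)}
    (hx : ‖x‖ ≤ d) (y : EuclideanSpace ℝ (Fin n)) :
    truncParab d (x + y) + truncParab d (x - y) - 2 * truncParab d x ≤ 2 * truncParab d y := by
  have h1 : truncParab d (x + y) ≤ ‖x + y‖ ^ 2 / d ^ 2 := min_le_left _ _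
  have h2 : truncParab d (x - y) ≤ ‖x - y‖ ^ 2 / d ^ 2 := min_le_left _ _
  have h3 : truncParab d (x + y) ≤ 1 := min_le_right _ _
  have h4 : truncParab d (x - y) ≤ 1 := min_le_right _ _
  have h5 := truncParab_nonneg d x
  have h6 : ‖x + y‖ ^ 2 / d ^ 2 + ‖x - y‖ ^ 2 / d ^ 2 =
      2 * (‖x‖ ^ 2 / d ^ 2) + 2 * (‖y‖ ^ 2 / d ^ 2) := by
    rw [← add_div, parallelogram_law_with_norm ℝ]
    ring
  have h7 := truncParab_eq_sq hd hx
  rcases min_choice (‖y‖ ^ 2 / d ^ 2) 1 with h | h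
  · rw [show truncParab d y = _ from h]
    linarith
  · rw [show truncParab d y = _ from h]
    linarith

/-! ### The fractional Laplacians at a touching point -/

lemma incr_neg (i : Fin k) (y : EuclideanSpace ℝ (Fin (N i))) : incr i (-y) = -incr i y := by
  simp [incr, Pi.single_neg]

lemma smul_eGroup (i : Fin k) (j : Fin (N i)) (τ : ℝ) :
    τ • eGroup i j = incr i (EuclideanSpace.single j τ) := by
  have : EuclideanSpace.single j τ = τ • EuclideanSpace.single j (1 : ℝ) := by
    ext l
    simp
  rw [this]
  simp [eGroup, incr, Pi.single_smul]

/-- If, in the `i`-th group of variables, the difference of `u` along two parallel copies of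
`ℝ^{N_i}` is touched from above by `C` times the truncated paraboloid, then the difference of
the `s`-Laplacians of `u` is at least `-2 C / (η d ^ (2 s))`. Only the two `s`-Laplacians of `u`
have to exist: that of the paraboloid is never formed, its second differences being estimated
under the integral. -/
lemma neg_le_fracLap_sub {i : Fin k} (hN : 1 ≤ N i) {s : ℝ} (hs : 0 < s) (hs1 : s ≤ 1) {d : ℝ}
    (hd : 0 < d) {C : ℝ} (hC : 0 ≤ C) {u : Space N → ℝ} {x x' : Space N}
    (h : FracLapExists i s u x) (h' : FracLapExists i s u x')
    {X : EuclideanSpace ℝ (Fin (N i))} (hX : ‖X‖ ≤ d)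
    (hle : ∀ y, u (x + incr i y) - u (x' + incr i y) ≤
      u x - u x' + C * (truncParab d (X + y) - truncParab d X)) :
    -(C * (2 / (eta (N i) s * d ^ (2 * s)))) ≤ fracLap i s u x - fracLap i s u x' := by
  unfold fracLap
  unfold FracLapExists at h h'
  split_ifs at h h' ⊢ with hs'
  · subst hs'
    have hj : ∀ j : Fin (N i), secondDeriv u (eGroup i j) x - secondDeriv u (eGroup i j) x' ≤
        2 * (C / d ^ 2) := fun j => by
      refine secondDeriv_sub_le (b := 2 * C * X j / d ^ 2) (h j) (h' j)
        (Filter.Eventually.of_forall fun τ => ?_)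
      rw [smul_eGroup]
      refine (hle _).trans ?_
      have h1 : truncParab d (X + EuclideanSpace.single j τ) ≤
          ‖X + EuclideanSpace.single j τ‖ ^ 2 / d ^ 2 := min_le_left _ _
      rw [norm_add_sq_real, PiLp.norm_single, EuclideanSpace.inner_single_right] at h1
      rw [truncParab_eq_sq hd hX]
      simp only [Real.norm_eq_abs, sq_abs, conj_trivial] at h1
      have h2 := mul_le_mul_of_nonneg_left h1 hC
      have h3 : C * ((‖X‖ ^ 2 + 2 * (τ * X j) + τ ^ 2) / d ^ 2) = C * (‖X‖ ^ 2 / d ^ 2) +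
        (2 * C * X j / d ^ 2 * τ + C / d ^ 2 * τ ^ 2) := by ring
      linarith
    have hsum := Finset.sum_le_sum fun j (_ : j ∈ Finset.univ) => hj j
    rw [Finset.sum_sub_distrib, Finset.sum_const, Finset.card_univ, Fintype.card_fin,
      nsmul_eq_mul] at hsum
    have hval : C * (2 / (eta (N i) 1 * d ^ (2 * (1 : ℝ)))) = N i * (2 * (C / d ^ 2)) * 2 := by
      have : (0 : ℝ) < N i := by exact_mod_cast hN
      rw [eta_one hN, mul_one, Real.rpow_two]
      field_simp
    have hpos : (0 : ℝ) ≤ N i * (2 * (C / d ^ 2)) := by positivity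
    rw [hval]
    linarith
  · have hs2 : s < 1 := lt_of_le_of_ne hs1 hs'
    obtain ⟨hint, hval⟩ := normConst_mul_integral_min_le hN hs hs2 hd
    have hc := normConst_nonneg hN hs
    rw [← mul_sub, ← integral_sub h h']
    have hmono : ∫ y : EuclideanSpace ℝ (Fin (N i)),
        -C * (2 * (truncParab d y / ‖y‖ ^ ((N i : ℝ) + 2 * s))) ≤
        ∫ y, (fracIntegrand i s u x y - fracIntegrand i s u x' y) := by
      refine integral_mono ((hint.const_mul 2).const_mul (-C)) (h.sub h') fun y => ?_
      have h1 := hle y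
      have h2 := hle (-y)
      rw [incr_neg, ← sub_eq_add_neg, ← sub_eq_add_neg, ← sub_eq_add_neg] at h2
      have h3 := mul_le_mul_of_nonneg_left (truncParab_second_diff_le hd hX y) hC
      have h4 : 0 ≤ ‖y‖ ^ ((N i : ℝ) + 2 * s) := by positivity
      simp only [fracIntegrand]
      rw [← sub_div, ← mul_div_assoc, ← mul_div_assoc]
      gcongr
      linarith
    rw [integral_const_mul] at hmono
    have h5 := mul_le_mul_of_nonneg_left hmono hc
    have h6 := mul_le_mul_of_nonneg_left hval hC
    simp only [truncParab] at h5
    linarith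

/-! ### Comparison with the barrier -/

/-- The maximum principle for the odd part of `u` in the last variable: on the product of the
balls with `[0, dLast]` it stays below the barrier
`2 M (∑ i, ‖X_i‖² / d_i² + t / dLast) + P t (dLast - t)`, the paraboloids being truncated. The
sign `σ` gives both signs of the odd part, without replacing `u` by its reflection. The strict
inequality `hP` makes the barrier a strict supersolution. -/
lemma reflect_sub_le_barrier (hN : ∀ i, 1 ≤ N i) {s : Fin k → ℝ} (hs : ∀ i, 0 < s i ∧ s i ≤ 1)
    {a : Fin k → ℝ} (ha : ∀ i, 0 ≤ a i) {aLast : ℝ} (haLast : 0 < aLast)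
    {d : Fin k → ℝ} (hd : ∀ i, 0 < d i) {dLast : ℝ} (hdLast : 0 < dLast)
    {f u : Space N → ℝ} (hu : IsClassicalSolution s a aLast (cylinder N d dLast 2) f u)
    {M S P : ℝ} (hM : ∀ x, |u x| ≤ M)
    (hS : ∀ X, (∀ i, ‖X i‖ < d i) → ∀ t ∈ Set.Ioo 0 dLast, |f (X, t) - f (X, -t)| ≤ S)
    (hP0 : 0 ≤ P)
    (hP : S + 2 * M * ∑ i, a i * (2 / (eta (N i) (s i) * d i ^ (2 * s i))) < 2 * aLast * P)
    {σ : ℝ} (hσ : σ = 1 ∨ σ = -1) {t : ℝ} (ht : t ∈ Set.Icc 0 dLast) :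
    u (0, σ * t) - u (0, -(σ * t)) ≤ 2 * M * (t / dLast) + P * (t * (dLast - t)) := by
  have hM0 : 0 ≤ M := (abs_nonneg _).trans (hM 0)
  set v : Space N → ℝ := fun p => u (p.1, σ * p.2) - u (p.1, -(σ * p.2)) with hv
  set W : Space N → ℝ := fun p =>
    2 * M * (∑ i, truncParab (d i) (p.1 i) + p.2 / dLast) + P * (p.2 * (dLast - p.2)) with hW
  have hvM : ∀ p, v p ≤ 2 * M := fun p => by
    have h1 := abs_le.1 (hM (p.1, σ * p.2))
    have h2 := abs_le.1 (hM (p.1, -(σ * p.2)))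
    simp only [hv]
    linarith [h1.2, h2.1]
  set D : Set (Space N) :=
    (Set.univ.pi fun i => Metric.closedBall (0 : EuclideanSpace ℝ (Fin (N i))) (d i)) ×ˢ
      Set.Icc 0 dLast with hD
  have hDc : IsCompact D :=
    (isCompact_univ_pi fun i => isCompact_closedBall _ _).prod isCompact_Icc
  have h0D : ((0, t) : Space N) ∈ D := by
    refine ⟨fun i _ => ?_, ht⟩
    simpa using (hd i).le
  have hcont : Continuous fun p => W p - v p := by
    have h1 := hu.continuous
    have h2 : ∀ i, Continuous fun p : Space N => truncParab (d i) (p.1 i) := fun i =>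
      (continuous_truncParab (d i)).comp (by fun_prop)
    simp only [hW, hv]
    fun_prop
  obtain ⟨p, hpD, hpmin⟩ := hDc.exists_isMinOn ⟨_, h0D⟩ hcont.continuousOn
  suffices hp : 0 ≤ W p - v p by
    have h := hp.trans (hpmin h0D)
    simp only [hW, hv, Pi.zero_apply, truncParab_zero, Finset.sum_const_zero, zero_add] at h
    linarith
  by_contra! hneg
  obtain ⟨X, r⟩ := p
  have hr : r ∈ Set.Icc 0 dLast := hpD.2
  have hsum0 : ∀ Y : (i : Fin k) → EuclideanSpace ℝ (Fin (N i)),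
      0 ≤ ∑ i, truncParab (d i) (Y i) :=
    fun Y => Finset.sum_nonneg fun i _ => truncParab_nonneg _ _
  have hr0 : 0 ≤ r / dLast := div_nonneg hr.1 hdLast.le
  have hPr : 0 ≤ P * (r * (dLast - r)) :=
    mul_nonneg hP0 (mul_nonneg hr.1 (sub_nonneg.2 hr.2))
  have hout : ∀ Y : (i : Fin k) → EuclideanSpace ℝ (Fin (N i)), (∃ i, d i ≤ ‖Y i‖) →
      0 ≤ W (Y, r) - v (Y, r) := by
    rintro Y ⟨i, hi⟩
    have h1 : 1 ≤ ∑ i, truncParab (d i) (Y i) := by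
      rw [← truncParab_eq_one (hd i) hi]
      exact Finset.single_le_sum (f := fun i => truncParab (d i) (Y i))
        (fun i _ => truncParab_nonneg _ _) (Finset.mem_univ i)
    have h2 := hvM (Y, r)
    have h3 : 2 * M * 1 ≤ 2 * M * (∑ i, truncParab (d i) (Y i) + r / dLast) := by
      gcongr
      linarith
    simp only [hW]
    linarith
  have hX : ∀ i, ‖X i‖ < d i := by
    by_contra! h
    exact absurd (hout X h) (not_le.2 hneg)
  have hr1 : 0 < r := by
    refine lt_of_le_of_ne hr.1 fun h => absurd hneg (not_lt.2 ?_)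
    have := hsum0 X
    simp only [hW, hv, ← h, mul_zero, neg_zero, sub_self, zero_div, add_zero, zero_mul, sub_zero]
    positivity
  have hr2 : r < dLast := by
    refine lt_of_le_of_ne hr.2 fun h => absurd hneg (not_lt.2 ?_)
    have h1 := hvM (X, r)
    have h2 := mul_nonneg (mul_nonneg zero_le_two hM0) (hsum0 X)
    have h3 : r / dLast = 1 := by rw [h, div_self hdLast.ne']
    simp only [hW, h3]
    linarith
  -- A negative minimum over the closed cylinder is global in the group variables, as the nonlocal
  -- terms require.
  have hglob : ∀ Y, W (X, r) - v (X, r) ≤ W (Y, r) - v (Y, r) := by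
    intro Y
    by_cases hY : ∃ i, d i ≤ ‖Y i‖
    · exact hneg.le.trans (hout Y hY)
    · push Not at hY
      exact hpmin (show ((Y, r) : Space N) ∈ D from
        ⟨fun i _ => by simpa using (hY i).le, hr⟩)
  have hx : ∀ ρ : ℝ, ρ = σ * r ∨ ρ = -(σ * r) → ((X, ρ) : Space N) ∈ cylinder N d dLast 2 := by
    intro ρ hρ
    have hρr : ρ = r ∨ ρ = -r := by
      rcases hσ with rfl | rfl <;> simpa [or_comm] using hρ
    refine ⟨fun i _ => by simpa using hX i, ?_⟩
    rcases hρr with rfl | rfl <;> constructor <;> simp only <;> linarith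
  have hx1 := hx _ (Or.inl rfl)
  have hx2 := hx _ (Or.inr rfl)
  have hdir : ∀ y : Space N, HasSecondDeriv u (eLast N) y →
      HasSecondDeriv u (σ • eLast N) y ∧ HasSecondDeriv u (-(σ • eLast N)) y ∧
      secondDeriv u (σ • eLast N) y = secondDeriv u (eLast N) y ∧
      secondDeriv u (-(σ • eLast N)) y = secondDeriv u (eLast N) y := by
    intro y hy
    rcases hσ with rfl | rfl
    · simpa [secondDeriv_neg_dir] using ⟨hy, hy.neg_dir⟩
    · simpa [secondDeriv_neg_dir] using ⟨hy.neg_dir, hy⟩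
  obtain ⟨hd1, -, he1, -⟩ := hdir _ (hu.hasSecondDeriv _ hx1)
  obtain ⟨-, hd2, -, he2⟩ := hdir _ (hu.hasSecondDeriv _ hx2)
  have htime : secondDeriv u (eLast N) (X, σ * r) - secondDeriv u (eLast N) (X, -(σ * r)) ≤
      2 * -P := by
    rw [← he1, ← he2]
    refine secondDeriv_sub_le (b := 2 * M / dLast + P * (dLast - 2 * r)) hd1 hd2 ?_
    have hnear : ∀ᶠ τ : ℝ in 𝓝 0, τ ∈ Set.Ioo (-r) (dLast - r) :=
      Ioo_mem_nhds (by linarith) (by linarith)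
    filter_upwards [hnear] with τ hτ
    have hq := hpmin (show ((X, r + τ) : Space N) ∈ D from
      ⟨hpD.1, by constructor <;> simp only <;> linarith [hτ.1, hτ.2]⟩)
    have e1 : ((X, σ * r) : Space N) + τ • σ • eLast N = (X, σ * (r + τ)) := by
      simp only [eLast, Prod.smul_mk, Prod.mk_add_mk, smul_zero, add_zero, smul_eq_mul]
      congr 1
      ring
    have e2 : ((X, -(σ * r)) : Space N) + τ • -(σ • eLast N) = (X, -(σ * (r + τ))) := by
      simp only [eLast, Prod.smul_mk, Prod.neg_mk, Prod.mk_add_mk, smul_zero, neg_zero, add_zero,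
        smul_eq_mul]
      congr 1
      ring
    rw [e1, e2]
    simp only [Set.mem_ofPred_eq, hW, hv, add_div] at hq
    have e3 : 2 * M * (τ / dLast) = 2 * M / dLast * τ := by ring
    linarith
  have hgroup : ∀ i, a i * -(2 * M * (2 / (eta (N i) (s i) * d i ^ (2 * s i)))) ≤
      a i * (fracLap i (s i) u (X, σ * r) - fracLap i (s i) u (X, -(σ * r))) := by
    intro i
    -- Where `a i = 0` the fractional Laplacian need not exist; its junk value is multiplied by `0`.
    rcases eq_or_ne (a i) 0 with hai | hai
    · simp [hai]
    refine mul_le_mul_of_nonneg_left ?_ (ha i)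
    refine neg_le_fracLap_sub (hN i) (hs i).1 (hs i).2 (hd i) (by positivity)
      (hu.fracLapExists _ hx1 i hai) (hu.fracLapExists _ hx2 i hai) (hX i).le fun y => ?_
    set Y : (l : Fin k) → EuclideanSpace ℝ (Fin (N l)) := X + Pi.single i y with hY
    have hy := hglob Y
    have e : ∀ ρ : ℝ, ((X, ρ) : Space N) + incr i y = (Y, ρ) := fun ρ => by
      simp [incr, hY]
    have hdiff : ∑ j, truncParab (d j) (Y j) - ∑ j, truncParab (d j) (X j) =
        truncParab (d i) (X i + y) - truncParab (d i) (X i) := by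
      rw [← Finset.sum_sub_distrib, Finset.sum_eq_single i]
      · simp [hY]
      · intro j _ hj
        simp [hY, Pi.single_eq_of_ne hj]
      · simp
    rw [e, e, ← hdiff]
    simp only [hW, hv] at hy
    linarith
  have hsum := Finset.sum_le_sum fun i (_ : i ∈ Finset.univ) => hgroup i
  have hsum1 : ∑ i, a i * -(2 * M * (2 / (eta (N i) (s i) * d i ^ (2 * s i)))) =
      -(2 * M * ∑ i, a i * (2 / (eta (N i) (s i) * d i ^ (2 * s i)))) := by
    rw [Finset.mul_sum, ← Finset.sum_neg_distrib]
    exact Finset.sum_congr rfl fun i _ => by ring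
  simp only [mul_sub, Finset.sum_sub_distrib] at hsum
  rw [hsum1] at hsum
  have hf1 := hu.eq _ hx1
  have hf2 := hu.eq _ hx2
  simp only [opL] at hf1 hf2
  have hfS : f (X, σ * r) - f (X, -(σ * r)) ≤ S := by
    have h := abs_le.1 (hS X hX r ⟨hr1, hr2⟩)
    rcases hσ with rfl | rfl
    · simpa using h.2
    · have := h.1
      simp only [neg_one_mul, neg_neg]
      linarith
  have := mul_le_mul_of_nonneg_left htime haLast.le
  linarith

/-- The estimate in real form, for finite bounds `M` and `S`. -/
lemma abs_reflect_sub_le (hN : ∀ i, 1 ≤ N i) {s : Fin k → ℝ} (hs : ∀ i, 0 < s i ∧ s i ≤ 1)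
    {a : Fin k → ℝ} (ha : ∀ i, 0 ≤ a i) {aLast : ℝ} (haLast : 0 < aLast)
    {d : Fin k → ℝ} (hd : ∀ i, 0 < d i) {dLast : ℝ} (hdLast : 0 < dLast)
    {f u : Space N → ℝ} (hu : IsClassicalSolution s a aLast (cylinder N d dLast 2) f u)
    {M S : ℝ} (hM : ∀ x, |u x| ≤ M) (hS0 : 0 ≤ S)
    (hS : ∀ X, (∀ i, ‖X i‖ < d i) → ∀ t ∈ Set.Ioo 0 dLast, |f (X, t) - f (X, -t)| ≤ S)
    {t : ℝ} (ht : |t| ≤ dLast) :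
    |u (0, t) - u (0, -t)| ≤ |t| * (2 * M / dLast + dLast *
      ((S + 2 * M * ∑ i, a i * (2 / (eta (N i) (s i) * d i ^ (2 * s i)))) / (2 * aLast))) := by
  have hM0 : 0 ≤ M := (abs_nonneg _).trans (hM 0)
  set B := ∑ i, a i * (2 / (eta (N i) (s i) * d i ^ (2 * s i))) with hB
  have hB0 : 0 ≤ B := Finset.sum_nonneg fun i _ => by
    have := eta_pos (hN i) (hs i).1
    have := Real.rpow_pos_of_pos (hd i) (2 * s i)
    have := ha i
    positivity
  have hP0 : 0 ≤ (S + 2 * M * B) / (2 * aLast) := by positivity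
  have key : ∀ σ : ℝ, σ = 1 ∨ σ = -1 → u (0, σ * |t|) - u (0, -(σ * |t|)) ≤
      |t| * (2 * M / dLast + dLast * ((S + 2 * M * B) / (2 * aLast))) := by
    intro σ hσ
    have hle : ∀ ε : ℝ, 0 < ε → u (0, σ * |t|) - u (0, -(σ * |t|)) ≤
        2 * M * (|t| / dLast) + ((S + 2 * M * B) / (2 * aLast) + ε) * (|t| * (dLast - |t|)) := by
      intro ε hε
      refine reflect_sub_le_barrier hN hs ha haLast hd hdLast hu hM hS (by positivity) ?_ hσ
        ⟨abs_nonneg t, ht⟩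
      rw [mul_add, mul_div_cancel₀ _ (by positivity)]
      linarith [mul_pos (mul_pos two_pos haLast) hε]
    have hlim : Filter.Tendsto (fun ε : ℝ => 2 * M * (|t| / dLast) +
        ((S + 2 * M * B) / (2 * aLast) + ε) * (|t| * (dLast - |t|))) (𝓝[>] 0)
        (𝓝 (2 * M * (|t| / dLast) +
          ((S + 2 * M * B) / (2 * aLast) + 0) * (|t| * (dLast - |t|)))) :=
      (Continuous.tendsto (by fun_prop) 0).mono_left nhdsWithin_le_nhds
    refine (ge_of_tendsto hlim ?_).trans ?_
    · filter_upwards [self_mem_nhdsWithin] with ε hε using hle ε hε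
    · have h1 : |t| * (dLast - |t|) ≤ |t| * dLast := by
        gcongr
        linarith [abs_nonneg t]
      have h2 := mul_le_mul_of_nonneg_left h1 hP0
      have h3 : 2 * M * (|t| / dLast) = |t| * (2 * M / dLast) := by ring
      rw [add_zero, h3]
      linarith
  have k1 := key 1 (Or.inl rfl)
  have k2 := key (-1) (Or.inr rfl)
  simp only [one_mul, neg_one_mul, neg_neg] at k1 k2
  rcases abs_choice t with h | h
  · rw [h] at k1 k2 ⊢
    exact abs_le.2 ⟨by linarith, k1⟩
  · rw [h] at k1 k2 ⊢
    rw [neg_neg] at k1 k2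
    exact abs_le.2 ⟨by linarith, k2⟩

lemma minEta_pos (hN : ∀ i, 1 ≤ N i) {s : Fin k → ℝ} (hs : ∀ i, 0 < s i)
    {d : Fin k → ℝ} (hd : ∀ i, 0 < d i) {dLast : ℝ} (hdLast : 0 < dLast) :
    0 < minEta N s d dLast := by
  unfold minEta
  rw [Finset.lt_fold_min]
  exact ⟨mul_pos (eta_pos le_rfl one_pos) (by positivity),
    fun i _ => mul_pos (eta_pos (hN i) (hs i)) (Real.rpow_pos_of_pos (hd i) _)⟩

lemma minEta_le (s d : Fin k → ℝ) (dLast : ℝ) (i : Fin k) :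
    minEta N s d dLast ≤ eta (N i) (s i) * d i ^ (2 * s i) := by
  unfold minEta
  rw [Finset.fold_min_le]
  exact Or.inr ⟨i, Finset.mem_univ i, le_rfl⟩

lemma minEta_le_last (s d : Fin k → ℝ) (dLast : ℝ) : minEta N s d dLast ≤ dLast ^ 2 / 2 := by
  unfold minEta
  rw [Finset.fold_min_le]
  left
  rw [eta_one le_rfl]
  apply le_of_eq
  push_cast
  ring

/-- A continuous function is bounded everywhere, not only almost everywhere, by its `L^∞` norm. -/
lemma abs_le_toReal_eLpNorm_top {u : Space N → ℝ} (hu : Continuous u)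
    (htop : eLpNorm u ⊤ volume ≠ ⊤) (x : Space N) : |u x| ≤ (eLpNorm u ⊤ volume).toReal := by
  by_contra! hlt
  have hopen : IsOpen {y | (eLpNorm u ⊤ volume).toReal < |u y|} :=
    isOpen_lt continuous_const hu.abs
  have hpos := hopen.measure_pos volume ⟨x, hlt⟩
  refine hpos.ne' (measure_mono_null (fun y hy => ?_)
    (ae_iff.1 (ae_le_eLpNormEssSup (f := u) (μ := volume))))
  rw [eLpNorm_exponent_top] at hy htop
  have hy' : (eLpNormEssSup u volume).toReal < |u y| := hy
  rw [Set.mem_ofPred_eq, not_le, Real.enorm_eq_ofReal_abs]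
  exact (ENNReal.lt_ofReal_iff_toReal_lt htop).2 hy'

end Aniso
end

/-- The inequality is one in `[0, ∞]`, so that it makes sense (and is trivial) also when `𝔖` or
the `L^∞` norm of `u` is infinite; both are multiplied by positive real constants. -/
theorem theorem1p1 {k : ℕ} (N : Fin k → ℕ) (hN : ∀ i, 1 ≤ N i)
    (s : Fin k → ℝ) (hs : ∀ i, 0 < s i ∧ s i ≤ 1)
    (a : Fin k → ℝ) (ha : ∀ i, 0 ≤ a i) (aLast : ℝ) (haLast : 0 < aLast)
    (d : Fin k → ℝ) (hd : ∀ i, 0 < d i) (dLast : ℝ) (hdLast : 0 < dLast)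
    (f u : Aniso.Space N → ℝ)
    (hu : Aniso.IsClassicalSolution s a aLast (Aniso.cylinder N d dLast 2) f u)
    (t : ℝ) (ht : t ∈ Set.Ioo (-dLast) dLast) (ht0 : t ≠ 0) :
    ENNReal.ofReal (|u (t • Aniso.eLast N) - u ((-t) • Aniso.eLast N)| / |t|) ≤
      ENNReal.ofReal (dLast / aLast) * Aniso.oscLast d dLast f +
        ENNReal.ofReal (Aniso.constC a aLast * dLast / Aniso.minEta N s d dLast) *
          MeasureTheory.eLpNorm u ⊤ MeasureTheory.volume := by
  have hA0 : 0 ≤ ∑ i, a i := Finset.sum_nonneg fun i _ => ha i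
  have hC0 : 0 < Aniso.constC a aLast := by
    unfold Aniso.constC
    positivity
  have hm0 := Aniso.minEta_pos hN (fun i => (hs i).1) hd hdLast
  have hSc : 0 < dLast / aLast := by positivity
  have hMc : 0 < Aniso.constC a aLast * dLast / Aniso.minEta N s d dLast := by positivity
  by_cases hStop : Aniso.oscLast d dLast f = ⊤
  · rw [hStop, ENNReal.mul_top (ENNReal.ofReal_pos.2 hSc).ne', top_add]
    exact le_top
  by_cases hMtop : eLpNorm u ⊤ volume = ⊤
  · rw [hMtop, ENNReal.mul_top (ENNReal.ofReal_pos.2 hMc).ne', add_top]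
    exact le_top
  set M := (eLpNorm u ⊤ volume).toReal with hM
  set S := (Aniso.oscLast d dLast f).toReal with hS
  have hM0 : 0 ≤ M := ENNReal.toReal_nonneg
  have hS0 : 0 ≤ S := ENNReal.toReal_nonneg
  have hfS : ∀ X : (i : Fin k) → EuclideanSpace ℝ (Fin (N i)), (∀ i, ‖X i‖ < d i) →
      ∀ r ∈ Set.Ioo 0 dLast, |f (X, r) - f (X, -r)| ≤ S := by
    intro X hX r hr
    have hX0 : ((X, 0) : Aniso.Space N) ∈ Aniso.cylinder N d dLast 1 :=
      ⟨fun i _ => by simpa using hX i, by simpa using hdLast⟩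
    have h : ENNReal.ofReal |f (((X, 0) : Aniso.Space N) + r • Aniso.eLast N) -
        f (((X, 0) : Aniso.Space N) - r • Aniso.eLast N)| ≤ Aniso.oscLast d dLast f :=
      le_iSup₂_of_le (f := fun x (_ : x ∈ Aniso.cylinder N d dLast 1) =>
        ⨆ t ∈ Set.Ioo 0 dLast,
          ENNReal.ofReal |f (x + t • Aniso.eLast N) - f (x - t • Aniso.eLast N)|)
        (X, 0) hX0 (le_iSup₂_of_le (f := fun t (_ : t ∈ Set.Ioo 0 dLast) =>
          ENNReal.ofReal |f (((X, 0) : Aniso.Space N) + t • Aniso.eLast N) -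
            f (((X, 0) : Aniso.Space N) - t • Aniso.eLast N)|) r hr le_rfl)
    have h' := (ENNReal.ofReal_le_iff_le_toReal hStop).1 h
    simpa [Aniso.eLast] using h'
  have hmain := Aniso.abs_reflect_sub_le hN hs ha haLast hd hdLast hu
    (Aniso.abs_le_toReal_eLpNorm_top hu.continuous hMtop) hS0 hfS (abs_lt.2 ht).le
  have ht' : 0 < |t| := abs_pos.2 ht0
  have hsum : ∑ i, a i * (2 / (Aniso.eta (N i) (s i) * d i ^ (2 * s i))) ≤
      (∑ i, a i) * (2 / Aniso.minEta N s d dLast) := by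
    rw [Finset.sum_mul]
    refine Finset.sum_le_sum fun i _ => mul_le_mul_of_nonneg_left ?_ (ha i)
    exact div_le_div_of_nonneg_left zero_le_two hm0 (Aniso.minEta_le s d dLast i)
  set m := Aniso.minEta N s d dLast with hm
  set A := ∑ i, a i with hA
  have hlast : 2 / dLast ≤ dLast / m := by
    rw [div_le_div_iff₀ hdLast hm0]
    linarith [Aniso.minEta_le_last (N := N) s d dLast]
  have hreal : |u (0, t) - u (0, -t)| / |t| ≤
      dLast / aLast * S + Aniso.constC a aLast * dLast / m * M := by
    rw [div_le_iff₀' ht']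
    refine hmain.trans (mul_le_mul_of_nonneg_left ?_ ht'.le)
    have h1 : dLast * ((S + 2 * M *
        ∑ i, a i * (2 / (Aniso.eta (N i) (s i) * d i ^ (2 * s i)))) / (2 * aLast)) ≤
        dLast * ((S + 2 * M * (A * (2 / m))) / (2 * aLast)) := by gcongr
    have h2 := mul_le_mul_of_nonneg_left hlast hM0
    have h3 : dLast * ((S + 2 * M * (A * (2 / m))) / (2 * aLast)) =
        dLast / aLast * S + 2 * A / aLast * dLast / m * M - dLast / aLast * S / 2 := by
      field_simp
      ring
    have h4 : Aniso.constC a aLast * dLast / m * M =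
        2 * A / aLast * dLast / m * M + 3 * (M * (dLast / m)) := by
      simp only [Aniso.constC, ← hA]
      field_simp
      ring
    have h5 : 0 ≤ dLast / aLast * S := by positivity
    have h6 : 0 ≤ M * (dLast / m) := by positivity
    have h7 : 2 * M / dLast = M * (2 / dLast) := by ring
    linarith
  have e : ∀ r : ℝ, r • Aniso.eLast N = (0, r) := fun r => by simp [Aniso.eLast]
  rw [e, e, ← ENNReal.ofReal_toReal hStop, ← ENNReal.ofReal_toReal hMtop, ← hM, ← hS,
    ← ENNReal.ofReal_mul hSc.le, ← ENNReal.ofReal_mul hMc.le,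
    ← ENNReal.ofReal_add (by positivity) (by positivity)]
  exact ENNReal.ofReal_le_ofReal hreal
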